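/- For a homogeneous polynomial $f \in \mathbb{C}[x,y,z]$ of degree $3$, let $\mathrm{R}(f)$ denote its Waring rank, that is, the smallest $r$ such that $f = \ell_1^3 + \cdots + \ell_r^3$ for some linear forms $\ell_1, \dots, \ell_r \in \mathbb{C}[x,y,z]$. Let $a,b,c \in \mathbb{C}$ and, for $\lambda \in \mathbb{C}$ with $\lambda \neq 0$, let $$f_\lambda = xyz + \lambda (ax+by+cz)^3.$$ - If $abc \neq 0$, then there is a unique nonzero $\lambda_0 \in \mathbb{C}$ (depending on $a,b,c$) such that, for every $\lambda \neq 0$, $\mathrm{R}(f_\lambda) = 3$ if $\lambda = \lambda_0$ and $\mathrm{R}(f_\lambda) = 4$ if $\lambda \neq \lambda_0$. - If $abc = 0$, then $\mathrm{R}(f_\lambda) = 4$ for every $\lambda \neq 0$. -/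

import Mathlib

/-- The Waring rank `R(f)` of a complex form `f` of degree `d` in the variables `σ`: the least `r`
such that `f` is a sum of `r` `d`-th powers of linear forms. The infimum in `ℕ` of the empty set
is `0`; a nonzero value is therefore always attained by a decomposition. -/
noncomputable def waringRank {σ : Type*} (d : ℕ) (f : MvPolynomial σ ℂ) : ℕ :=
  sInf {r : ℕ | ∃ ℓ : Fin r → MvPolynomial σ ℂ,
    (∀ i, (ℓ i).IsHomogeneous 1) ∧ f = ∑ i, ℓ i ^ d}

/-- The linear form `ℓ = a x + b y + c z` in `ℂ[x, y, z]`. -/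
noncomputable def linForm (a b c : ℂ) : MvPolynomial (Fin 3) ℂ :=
  MvPolynomial.C a * MvPolynomial.X 0 + MvPolynomial.C b * MvPolynomial.X 1
    + MvPolynomial.C c * MvPolynomial.X 2

/-- The ternary cubic `xyz + t (a x + b y + c z)³` in `ℂ[x, y, z]`. -/
noncomputable def cubicForm (a b c t : ℂ) : MvPolynomial (Fin 3) ℂ :=
  MvPolynomial.X 0 * MvPolynomial.X 1 * MvPolynomial.X 2 + MvPolynomial.C t * linForm a b c ^ 3

open MvPolynomial

/-! Two determinantal-type obstructions give the lower bounds. The Aronhold invariant vanishes on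
sums of three cubes, and on `xyz + tℓ³` it is `-(1 + 24abct)/1296`, so rank at most 3 forces `t =
-1/(24abc)`. In particular it never happens when `abc = 0`. At that value a catalecticant minor,
proportional to `1 + 18abct`, rules out two cubes. For the upper bounds with `abc ≠ 0`, `24abc·xyz`
is `ℓ³` minus the cubes of the three forms obtained from `ℓ` by changing one sign. Thus four cubes
suffice, and the coefficient of `ℓ³` vanishes exactly at the special `t`. For `abc = 0`, four cubes
are written down explicitly. -/

/-- The coefficients of the ternary cubic `∑ ℓᵢ³` with `ℓᵢ = pᵢ x + qᵢ y + rᵢ z`, normalised by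
multinomial coefficients, agree with those of `cubicForm a b c t`. -/
structure CubicDecomposition (n : ℕ) (a b c t : ℂ) (p q r : Fin n → ℂ) : Prop where
  xxx : t * a ^ 3 = ∑ i, p i ^ 3
  yyy : t * b ^ 3 = ∑ i, q i ^ 3
  zzz : t * c ^ 3 = ∑ i, r i ^ 3
  xxy : t * (a ^ 2 * b) = ∑ i, p i ^ 2 * q i
  xxz : t * (a ^ 2 * c) = ∑ i, p i ^ 2 * r i
  xyy : t * (a * b ^ 2) = ∑ i, p i * q i ^ 2
  yyz : t * (b ^ 2 * c) = ∑ i, q i ^ 2 * r i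
  xzz : t * (a * c ^ 2) = ∑ i, p i * r i ^ 2
  yzz : t * (b * c ^ 2) = ∑ i, q i * r i ^ 2
  xyz : 1 / 6 + t * (a * b * c) = ∑ i, p i * q i * r i

/-! ### From polynomial identities to coefficient equations -/

/-- A linear form evaluates to a linear combination of the coordinates. -/
theorem eval_of_isHomogeneous_one {ℓ : MvPolynomial (Fin 3) ℂ} (h : ℓ.IsHomogeneous 1) :
    ∃ p q r : ℂ, ∀ x y z : ℂ, eval ![x, y, z] ℓ = p * x + q * y + r * z := by
  have hs : ∀ v : Fin 3 → ℂ, eval v ℓ = ∑ i, coeff (Finsupp.single i 1) ℓ * v i := by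
    intro v
    rw [eval_eq]
    have hsub : ℓ.support ⊆ Finset.univ.image (fun i : Fin 3 => Finsupp.single i 1) := by
      intro d hd
      have hdeg : d.degree = 1 := by
        rw [Finsupp.degree_eq_weight_one]
        exact h (mem_support_iff.mp hd)
      obtain ⟨i, hi⟩ := (Finsupp.sum_eq_one_iff d).mp hdeg
      exact Finset.mem_image.mpr ⟨i, Finset.mem_univ _, hi.symm⟩
    rw [Finset.sum_subset hsub (fun d _ hd => by simp [notMem_support_iff.mp hd]),
      Finset.sum_image (fun i _ j _ hij => (Finsupp.single_left_inj one_ne_zero).mp hij)]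
    refine Finset.sum_congr rfl fun i _ => ?_
    congr 1
    rw [Finset.prod_eq_single i]
    · simp
    · intro j _ hj
      simp [hj.symm]
    · simp
  refine ⟨coeff (Finsupp.single 0 1) ℓ, coeff (Finsupp.single 1 1) ℓ,
    coeff (Finsupp.single 2 1) ℓ, fun x y z => ?_⟩
  rw [hs, Fin.sum_univ_three]
  rfl

/-- A Waring decomposition of `cubicForm a b c t` gives a system of equations in the coefficients
of the linear forms. -/
theorem exists_cubicDecomposition {n : ℕ} {a b c t : ℂ}
    (h : ∃ ℓ : Fin n → MvPolynomial (Fin 3) ℂ,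
      (∀ i, (ℓ i).IsHomogeneous 1) ∧ cubicForm a b c t = ∑ i, ℓ i ^ 3) :
    ∃ p q r : Fin n → ℂ, CubicDecomposition n a b c t p q r := by
  obtain ⟨ℓ, hℓ, hf⟩ := h
  choose p q r hpqr using fun i => eval_of_isHomogeneous_one (hℓ i)
  have key : ∀ x y z : ℂ, x * y * z + t * (a * x + b * y + c * z) ^ 3
      = (∑ i, p i ^ 3) * x ^ 3 + (∑ i, q i ^ 3) * y ^ 3 + (∑ i, r i ^ 3) * z ^ 3
        + 3 * (∑ i, p i ^ 2 * q i) * (x ^ 2 * y) + 3 * (∑ i, p i ^ 2 * r i) * (x ^ 2 * z)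
        + 3 * (∑ i, p i * q i ^ 2) * (x * y ^ 2) + 3 * (∑ i, q i ^ 2 * r i) * (y ^ 2 * z)
        + 3 * (∑ i, p i * r i ^ 2) * (x * z ^ 2) + 3 * (∑ i, q i * r i ^ 2) * (y * z ^ 2)
        + 6 * (∑ i, p i * q i * r i) * (x * y * z) := by
    intro x y z
    have h1 := congrArg (eval ![x, y, z]) hf
    simp only [cubicForm, linForm, map_add, map_mul, map_pow, map_sum, eval_C, eval_X,
      hpqr] at h1
    simp only [Matrix.cons_val_zero, Matrix.cons_val_one, Matrix.cons_val] at h1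
    rw [h1]
    simp only [Finset.mul_sum, Finset.sum_mul, ← Finset.sum_add_distrib]
    exact Finset.sum_congr rfl fun i _ => by ring
  generalize hxxx : ∑ i, p i ^ 3 = xxx at key
  generalize hyyy : ∑ i, q i ^ 3 = yyy at key
  generalize hzzz : ∑ i, r i ^ 3 = zzz at key
  generalize hxxy : ∑ i, p i ^ 2 * q i = xxy at key
  generalize hxxz : ∑ i, p i ^ 2 * r i = xxz at key
  generalize hxyy : ∑ i, p i * q i ^ 2 = xyy at key
  generalize hyyz : ∑ i, q i ^ 2 * r i = yyz at key
  generalize hxzz : ∑ i, p i * r i ^ 2 = xzz at key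
  generalize hyzz : ∑ i, q i * r i ^ 2 = yzz at key
  generalize hxyz : ∑ i, p i * q i * r i = xyz at key
  -- A ternary cubic has ten coefficients; these ten points determine them all.
  have k1 := key 1 0 0
  have k2 := key 0 1 0
  have k3 := key 0 0 1
  have k4 := key 1 1 0
  have k5 := key 1 (-1) 0
  have k6 := key 1 0 1
  have k7 := key 1 0 (-1)
  have k8 := key 0 1 1
  have k9 := key 0 1 (-1)
  have k10 := key 1 1 1
  have e1 : t * a ^ 3 = xxx := by linear_combination k1
  have e2 : t * b ^ 3 = yyy := by linear_combination k2
  have e3 : t * c ^ 3 = zzz := by linear_combination k3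
  have e4 : t * (a ^ 2 * b) = xxy := by linear_combination (k4 - k5) / 6 - e2 / 3
  have e5 : t * (a ^ 2 * c) = xxz := by linear_combination (k6 - k7) / 6 - e3 / 3
  have e6 : t * (a * b ^ 2) = xyy := by linear_combination (k4 + k5) / 6 - e1 / 3
  have e7 : t * (b ^ 2 * c) = yyz := by linear_combination (k8 - k9) / 6 - e3 / 3
  have e8 : t * (a * c ^ 2) = xzz := by linear_combination (k6 + k7) / 6 - e1 / 3
  have e9 : t * (b * c ^ 2) = yzz := by linear_combination (k8 + k9) / 6 - e2 / 3
  have e10 : 1 / 6 + t * (a * b * c) = xyz := by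
    linear_combination (k10 - e1 - e2 - e3) / 6 - (e4 + e5 + e6 + e7 + e8 + e9) / 2
  exact ⟨p, q, r, by subst_vars; constructor <;> assumption⟩

/-! ### Obstructions to few cubes -/

/-- The Aronhold invariant of the ternary cubic with normalised coefficients
`a, b, c` (of `x³, y³, z³`), `a₂, a₃` (of `x²y, x²z`), `b₁, b₃` (of `xy², y²z`),
`c₁, c₂` (of `xz², yz²`) and `m` (of `xyz`). -/
def aronhold (a b c a₂ a₃ b₁ b₃ c₁ c₂ m : ℂ) : ℂ :=
  a * b * c * m - (b * c * a₂ * a₃ + c * a * b₁ * b₃ + a * b * c₁ * c₂)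
    - m * (a * b₃ * c₂ + b * c₁ * a₃ + c * a₂ * b₁)
    + (a * b₁ * c₂ ^ 2 + a * c₁ * b₃ ^ 2 + b * a₂ * c₁ ^ 2 + b * c₂ * a₃ ^ 2
      + c * b₃ * a₂ ^ 2 + c * a₃ * b₁ ^ 2)
    - m ^ 4 + 2 * m ^ 2 * (b₁ * c₁ + c₂ * a₂ + a₃ * b₃)
    - 3 * m * (a₂ * b₃ * c₁ + a₃ * b₁ * c₂)
    - (b₁ ^ 2 * c₁ ^ 2 + c₂ ^ 2 * a₂ ^ 2 + a₃ ^ 2 * b₃ ^ 2)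
    + (c₂ * a₂ * a₃ * b₃ + a₃ * b₃ * b₁ * c₁ + b₁ * c₁ * c₂ * a₂)

/-- The Aronhold invariant vanishes on sums of three cubes. -/
theorem aronhold_sum_three_cubes (p q r : Fin 3 → ℂ) :
    aronhold (∑ i, p i ^ 3) (∑ i, q i ^ 3) (∑ i, r i ^ 3) (∑ i, p i ^ 2 * q i)
      (∑ i, p i ^ 2 * r i) (∑ i, p i * q i ^ 2) (∑ i, q i ^ 2 * r i) (∑ i, p i * r i ^ 2)
      (∑ i, q i * r i ^ 2) (∑ i, p i * q i * r i) = 0 := by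
  simp only [Fin.sum_univ_three, aronhold]
  ring

theorem CubicDecomposition.aronhold_eq_zero {a b c t : ℂ} {p q r : Fin 3 → ℂ}
    (h : CubicDecomposition 3 a b c t p q r) : 1 + 24 * (a * b * c) * t = 0 := by
  have hS := aronhold_sum_three_cubes p q r
  rw [← h.xxx, ← h.yyy, ← h.zzz, ← h.xxy, ← h.xxz, ← h.xyy, ← h.yyz, ← h.xzz, ← h.yzz,
    ← h.xyz] at hS
  unfold aronhold at hS
  linear_combination (-1296) * hS

/-- The vanishing of a catalecticant minor of a sum of two cubes. -/
theorem CubicDecomposition.minor_eq_zero {a b c t : ℂ} {p q r : Fin 2 → ℂ}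
    (h : CubicDecomposition 2 a b c t p q r) : 1 + 18 * (a * b * c) * t = 0 := by
  have hD : ∀ m a₂ a₃ b₁ b₃ c₁ c₂ : ℂ, m = ∑ i, p i * q i * r i → a₂ = ∑ i, p i ^ 2 * q i →
      a₃ = ∑ i, p i ^ 2 * r i → b₁ = ∑ i, p i * q i ^ 2 → b₃ = ∑ i, q i ^ 2 * r i →
      c₁ = ∑ i, p i * r i ^ 2 → c₂ = ∑ i, q i * r i ^ 2 →
      -- Determinant of the catalecticant block with rows `x, y, z` and columns `yz, xz, xy`. Each
      -- cube contributes a rank-one matrix, so two cubes give rank at most 2.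
      m * (m * m - b₁ * c₁) - a₃ * (b₃ * m - b₁ * c₂) + a₂ * (b₃ * c₁ - m * c₂) = 0 := by
    intro m a₂ a₃ b₁ b₃ c₁ c₂ h1 h2 h3 h4 h5 h6 h7
    rw [h1, h2, h3, h4, h5, h6, h7]
    simp only [Fin.sum_univ_two]
    ring
  have := hD _ _ _ _ _ _ _ h.xyz h.xxy h.xxz h.xyy h.yyz h.xzz h.yzz
  linear_combination 216 * this

/-! ### Generalities on Waring rank -/

/-- A sum of `r` cubes is also a sum of `s ≥ r` cubes. -/
theorem exists_sum_pow_of_le {σ : Type*} {d r s : ℕ} (hd : d ≠ 0) (hrs : r ≤ s)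
    {f : MvPolynomial σ ℂ}
    (h : ∃ ℓ : Fin r → MvPolynomial σ ℂ, (∀ i, (ℓ i).IsHomogeneous 1) ∧ f = ∑ i, ℓ i ^ d) :
    ∃ ℓ : Fin s → MvPolynomial σ ℂ, (∀ i, (ℓ i).IsHomogeneous 1) ∧ f = ∑ i, ℓ i ^ d := by
  induction s, hrs using Nat.le_induction with
  | base => exact h
  | succ s _ ih =>
    obtain ⟨ℓ, hℓ, rfl⟩ := ih
    -- Padding by the zero form is harmless because `d ≠ 0`.
    refine ⟨Fin.snoc ℓ 0, fun i => ?_, ?_⟩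
    · refine Fin.lastCases ?_ (fun j => ?_) i
      · simpa using isHomogeneous_zero σ ℂ 1
      · simpa using hℓ j
    · simp [Fin.sum_univ_castSucc, hd]

/-- The rank is `n + 1` when `n + 1` powers suffice and `n` do not. -/
theorem waringRank_eq_succ {σ : Type*} {d n : ℕ} (hd : d ≠ 0) {f : MvPolynomial σ ℂ}
    (hle : ∃ ℓ : Fin (n + 1) → MvPolynomial σ ℂ,
      (∀ i, (ℓ i).IsHomogeneous 1) ∧ f = ∑ i, ℓ i ^ d)
    (hlt : ¬ ∃ ℓ : Fin n → MvPolynomial σ ℂ,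
      (∀ i, (ℓ i).IsHomogeneous 1) ∧ f = ∑ i, ℓ i ^ d) :
    waringRank d f = n + 1 := by
  refine le_antisymm (Nat.sInf_le hle) ?_
  by_contra! hcon
  have hmem : waringRank d f ∈ {r : ℕ | ∃ ℓ : Fin r → MvPolynomial σ ℂ,
      (∀ i, (ℓ i).IsHomogeneous 1) ∧ f = ∑ i, ℓ i ^ d} := Nat.sInf_mem ⟨_, hle⟩
  exact hlt (exists_sum_pow_of_le hd (Nat.lt_succ_iff.mp hcon) hmem)

/-- Scalars may be absorbed in a sum of powers of linear forms. -/
theorem exists_sum_pow_of_sum_C_mul_pow {σ : Type*} {d n : ℕ} (hd : d ≠ 0)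
    {f : MvPolynomial σ ℂ} (k : Fin n → ℂ) (ℓ : Fin n → MvPolynomial σ ℂ)
    (hℓ : ∀ i, (ℓ i).IsHomogeneous 1) (hf : f = ∑ i, C (k i) * ℓ i ^ d) :
    ∃ ℓ : Fin n → MvPolynomial σ ℂ, (∀ i, (ℓ i).IsHomogeneous 1) ∧ f = ∑ i, ℓ i ^ d := by
  choose w hw using fun i => IsAlgClosed.exists_pow_nat_eq (k i) (Nat.pos_of_ne_zero hd)
  refine ⟨fun i => C (w i) * ℓ i, fun i => (hℓ i).C_mul _, hf.trans ?_⟩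
  refine Finset.sum_congr rfl fun i _ => ?_
  rw [mul_pow, ← C_pow, hw]

theorem isHomogeneous_linear_combination {σ : Type*} {x y z : MvPolynomial σ ℂ}
    (hx : x.IsHomogeneous 1) (hy : y.IsHomogeneous 1) (hz : z.IsHomogeneous 1) (a b c : ℂ) :
    (C a * x + C b * y + C c * z).IsHomogeneous 1 :=
  ((hx.C_mul a).add (hy.C_mul b)).add (hz.C_mul c)

/-- If a form is a combination of cubes of the linear forms `pᵢ x + qᵢ y + rᵢ z`, then it is a sum
of cubes. -/
theorem exists_sum_cubes {σ : Type*} {n : ℕ} {f x y z : MvPolynomial σ ℂ}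
    (hx : x.IsHomogeneous 1) (hy : y.IsHomogeneous 1) (hz : z.IsHomogeneous 1)
    (k p q r : Fin n → ℂ)
    (hf : f = ∑ i, C (k i) * (C (p i) * x + C (q i) * y + C (r i) * z) ^ 3) :
    ∃ ℓ : Fin n → MvPolynomial σ ℂ, (∀ i, (ℓ i).IsHomogeneous 1) ∧ f = ∑ i, ℓ i ^ 3 :=
  exists_sum_pow_of_sum_C_mul_pow three_ne_zero k _
    (fun i => isHomogeneous_linear_combination hx hy hz (p i) (q i) (r i)) hf

/-! ### Explicit decompositions -/

/-- Comparing coefficients of two cubics in `x, y, z`. -/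
theorem cubic_eq_sum {σ : Type*} {n : ℕ} (x y z : MvPolynomial σ ℂ) {a b c t : ℂ}
    {k p q r : Fin n → ℂ}
    (xxx : t * a ^ 3 = ∑ i, k i * p i ^ 3)
    (yyy : t * b ^ 3 = ∑ i, k i * q i ^ 3)
    (zzz : t * c ^ 3 = ∑ i, k i * r i ^ 3)
    (xxy : t * (a ^ 2 * b) = ∑ i, k i * (p i ^ 2 * q i))
    (xxz : t * (a ^ 2 * c) = ∑ i, k i * (p i ^ 2 * r i))
    (xyy : t * (a * b ^ 2) = ∑ i, k i * (p i * q i ^ 2))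
    (yyz : t * (b ^ 2 * c) = ∑ i, k i * (q i ^ 2 * r i))
    (xzz : t * (a * c ^ 2) = ∑ i, k i * (p i * r i ^ 2))
    (yzz : t * (b * c ^ 2) = ∑ i, k i * (q i * r i ^ 2))
    (xyz : 1 / 6 + t * (a * b * c) = ∑ i, k i * (p i * q i * r i)) :
    x * y * z + C t * (C a * x + C b * y + C c * z) ^ 3
      = ∑ i, C (k i) * (C (p i) * x + C (q i) * y + C (r i) * z) ^ 3 := by
  have h6 : (6 : MvPolynomial σ ℂ) * C (1 / 6) = 1 := by
    rw [show (6 : MvPolynomial σ ℂ) = C 6 from rfl, ← C_mul]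
    norm_num
  have hr : ∑ i, C (k i) * (C (p i) * x + C (q i) * y + C (r i) * z) ^ 3
      = C (∑ i, k i * p i ^ 3) * x ^ 3 + C (∑ i, k i * q i ^ 3) * y ^ 3
        + C (∑ i, k i * r i ^ 3) * z ^ 3
        + 3 * C (∑ i, k i * (p i ^ 2 * q i)) * (x ^ 2 * y)
        + 3 * C (∑ i, k i * (p i ^ 2 * r i)) * (x ^ 2 * z)
        + 3 * C (∑ i, k i * (p i * q i ^ 2)) * (x * y ^ 2)
        + 3 * C (∑ i, k i * (q i ^ 2 * r i)) * (y ^ 2 * z)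
        + 3 * C (∑ i, k i * (p i * r i ^ 2)) * (x * z ^ 2)
        + 3 * C (∑ i, k i * (q i * r i ^ 2)) * (y * z ^ 2)
        + 6 * C (∑ i, k i * (p i * q i * r i)) * (x * y * z) := by
    simp only [map_sum, map_mul, map_pow, Finset.mul_sum, Finset.sum_mul,
      ← Finset.sum_add_distrib]
    exact Finset.sum_congr rfl fun i _ => by ring
  rw [hr, ← xxx, ← yyy, ← zzz, ← xxy, ← xxz, ← xyy, ← yyz, ← xzz, ← yzz, ← xyz]
  simp only [map_add, map_mul, map_pow]
  linear_combination (-(x * y * z)) * h6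

/-- The decomposition of `xyz + t (a x + b y + c z)³` for `abc ≠ 0` by the sign changes of
`a x + b y + c z`. -/
theorem cubicForm_eq_sum_signs {a b c : ℂ} (h : a * b * c ≠ 0) (t : ℂ) :
    cubicForm a b c t = C (t + 1 / (24 * (a * b * c))) * linForm a b c ^ 3
      + ∑ i : Fin 3, C (-1 / (24 * (a * b * c))) *
        (C (![-a, a, a] i) * X 0 + C (![b, -b, b] i) * X 1 + C (![c, c, -c] i) * X 2) ^ 3 := by
  have ha : a ≠ 0 := by rintro rfl; simp at h
  have hb : b ≠ 0 := by rintro rfl; simp at h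
  have hc : c ≠ 0 := by rintro rfl; simp at h
  have := cubic_eq_sum (n := 4) (X 0 : MvPolynomial (Fin 3) ℂ) (X 1) (X 2)
    (a := a) (b := b) (c := c) (t := t)
    (k := ![t + 1 / (24 * (a * b * c)), -1 / (24 * (a * b * c)), -1 / (24 * (a * b * c)),
      -1 / (24 * (a * b * c))])
    (p := ![a, -a, a, a]) (q := ![b, b, -b, b]) (r := ![c, c, c, -c])
    (by simp [Fin.sum_univ_four]; field_simp; ring) (by simp [Fin.sum_univ_four]; field_simp; ring)
    (by simp [Fin.sum_univ_four]; field_simp; ring) (by simp [Fin.sum_univ_four]; field_simp; ring)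
    (by simp [Fin.sum_univ_four]; field_simp; ring) (by simp [Fin.sum_univ_four]; field_simp; ring)
    (by simp [Fin.sum_univ_four]; field_simp; ring) (by simp [Fin.sum_univ_four]; field_simp; ring)
    (by simp [Fin.sum_univ_four]; field_simp; ring) (by simp [Fin.sum_univ_four]; field_simp; ring)
  rw [cubicForm, linForm, this, Fin.sum_univ_succ]
  rfl

/-- `xyz + t (a x + b y)³` is a sum of four cubes if `tab ≠ 0`. -/
theorem exists_sum_four_cubes_of_ne_zero {σ : Type*} {x y z : MvPolynomial σ ℂ}
    (hx : x.IsHomogeneous 1) (hy : y.IsHomogeneous 1) (hz : z.IsHomogeneous 1) {a b t : ℂ}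
    (ha : a ≠ 0) (hb : b ≠ 0) (ht : t ≠ 0) :
    ∃ ℓ : Fin 4 → MvPolynomial σ ℂ, (∀ i, (ℓ i).IsHomogeneous 1) ∧
      x * y * z + C t * (C a * x + C b * y + C 0 * z) ^ 3 = ∑ i, ℓ i ^ 3 := by
  -- With `U = ax - by`, `V = ax + by`, the form is `(V² - U²)z/(4ab) + tV³`. For `s = 8tab`, the
  -- cubes of `z ± sU` produce the `U²z` term and an extra `z³`; those of `z + 2sV` and `z - sV/2`
  -- produce the rest and cancel that `z³`.
  refine exists_sum_cubes hx hy hz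
    ![-1 / (1536 * t ^ 2 * (a * b) ^ 3), -1 / (1536 * t ^ 2 * (a * b) ^ 3),
      1 / (3840 * t ^ 2 * (a * b) ^ 3), 1 / (960 * t ^ 2 * (a * b) ^ 3)]
    ![8 * t * a * (a * b), -8 * t * a * (a * b), 16 * t * a * (a * b), -4 * t * a * (a * b)]
    ![-8 * t * b * (a * b), 8 * t * b * (a * b), 16 * t * b * (a * b), -4 * t * b * (a * b)]
    ![1, 1, 1, 1] (cubic_eq_sum x y z ?_ ?_ ?_ ?_ ?_ ?_ ?_ ?_ ?_ ?_) <;>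
  · simp [Fin.sum_univ_four]
    try field_simp
    try ring

/-- `xyz + t (a x)³` is a sum of four cubes. -/
theorem exists_sum_four_cubes_of_eq_zero {σ : Type*} {x y z : MvPolynomial σ ℂ}
    (hx : x.IsHomogeneous 1) (hy : y.IsHomogeneous 1) (hz : z.IsHomogeneous 1) (a t : ℂ) :
    ∃ ℓ : Fin 4 → MvPolynomial σ ℂ, (∀ i, (ℓ i).IsHomogeneous 1) ∧
      x * y * z + C t * (C a * x + C 0 * y + C 0 * z) ^ 3 = ∑ i, ℓ i ^ 3 := by
  -- The cubes of `ux ± (y + z)`, weighted by `1/(24u)`, sum to `u²x³/12 + x(y + z)²/4`. Subtracting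
  -- the analogue for `v` and `y - z` leaves `xyz + (u² - v²)x³/12`.
  obtain ⟨u, v, hu, hv, huv⟩ :
      ∃ u v : ℂ, u ≠ 0 ∧ v ≠ 0 ∧ t * a ^ 3 = (u ^ 2 - v ^ 2) / 12 := by
    -- Here `g` will be `u + v`, so that `u - v = 12ta³/g`; the conditions keep `u` and `v` nonzero.
    obtain ⟨g, hg, hg1, hg2⟩ :
        ∃ g : ℂ, g ≠ 0 ∧ g ^ 2 + 12 * (t * a ^ 3) ≠ 0 ∧ g ^ 2 - 12 * (t * a ^ 3) ≠ 0 := by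
      generalize t * a ^ 3 = s
      by_cases h1 : 1 + 12 * s = 0
      · refine ⟨2, two_ne_zero, fun h => ?_, fun h => ?_⟩
        · exact absurd (show (3 : ℂ) = 0 by linear_combination h - h1) three_ne_zero
        · exact absurd (show (5 : ℂ) = 0 by linear_combination h + h1) (by norm_num)
      by_cases h2 : 1 - 12 * s = 0
      · refine ⟨2, two_ne_zero, fun h => ?_, fun h => ?_⟩
        · exact absurd (show (5 : ℂ) = 0 by linear_combination h + h2) (by norm_num)
        · exact absurd (show (3 : ℂ) = 0 by linear_combination h - h2) three_ne_zero
      exact ⟨1, one_ne_zero, by simpa using h1, by simpa using h2⟩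
    refine ⟨(g ^ 2 + 12 * (t * a ^ 3)) / (2 * g), (g ^ 2 - 12 * (t * a ^ 3)) / (2 * g),
      div_ne_zero hg1 (by simpa using hg), div_ne_zero hg2 (by simpa using hg), ?_⟩
    field_simp
    ring
  refine exists_sum_cubes hx hy hz
    ![1 / (24 * u), 1 / (24 * u), -1 / (24 * v), -1 / (24 * v)]
    ![u, u, v, v] ![1, -1, 1, -1] ![1, -1, -1, 1]
    (cubic_eq_sum x y z ?_ ?_ ?_ ?_ ?_ ?_ ?_ ?_ ?_ ?_) <;>
  · simp [Fin.sum_univ_four, huv]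
    try field_simp
    try ring

/-- `xyz + t (a x + b y)³` is a sum of four cubes. -/
theorem exists_sum_four_cubes {σ : Type*} {x y z : MvPolynomial σ ℂ}
    (hx : x.IsHomogeneous 1) (hy : y.IsHomogeneous 1) (hz : z.IsHomogeneous 1) {t : ℂ}
    (ht : t ≠ 0) (a b : ℂ) :
    ∃ ℓ : Fin 4 → MvPolynomial σ ℂ, (∀ i, (ℓ i).IsHomogeneous 1) ∧
      x * y * z + C t * (C a * x + C b * y + C 0 * z) ^ 3 = ∑ i, ℓ i ^ 3 := by
  by_cases hb : b = 0
  · subst hb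
    exact exists_sum_four_cubes_of_eq_zero hx hy hz a t
  by_cases ha : a = 0
  · subst ha
    obtain ⟨ℓ, hℓ, h⟩ := exists_sum_four_cubes_of_eq_zero hy hx hz b t
    exact ⟨ℓ, hℓ, by rw [← h]; ring⟩
  exact exists_sum_four_cubes_of_ne_zero hx hy hz ha hb ht

theorem cubicForm_exists_sum_four_cubes (a b c : ℂ) {t : ℂ} (ht : t ≠ 0) :
    ∃ ℓ : Fin 4 → MvPolynomial (Fin 3) ℂ, (∀ i, (ℓ i).IsHomogeneous 1) ∧
      cubicForm a b c t = ∑ i, ℓ i ^ 3 := by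
  have hX : ∀ i : Fin 3, (X i : MvPolynomial (Fin 3) ℂ).IsHomogeneous 1 := isHomogeneous_X ℂ
  by_cases h : a * b * c = 0
  · rcases mul_eq_zero.mp h with h | rfl
    · rcases mul_eq_zero.mp h with rfl | rfl
      · obtain ⟨ℓ, hℓ, h⟩ := exists_sum_four_cubes (hX 1) (hX 2) (hX 0) ht b c
        exact ⟨ℓ, hℓ, by rw [← h, cubicForm, linForm]; ring⟩
      · obtain ⟨ℓ, hℓ, h⟩ := exists_sum_four_cubes (hX 0) (hX 2) (hX 1) ht a c
        exact ⟨ℓ, hℓ, by rw [← h, cubicForm, linForm]; ring⟩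
    · obtain ⟨ℓ, hℓ, h⟩ := exists_sum_four_cubes (hX 0) (hX 1) (hX 2) ht a b
      exact ⟨ℓ, hℓ, by rw [← h, cubicForm, linForm]⟩
  · refine exists_sum_cubes (hX 0) (hX 1) (hX 2)
      (Fin.cons (t + 1 / (24 * (a * b * c))) fun _ : Fin 3 => -1 / (24 * (a * b * c)))
      (Fin.cons a ![-a, a, a]) (Fin.cons b ![b, -b, b]) (Fin.cons c ![c, c, -c]) ?_
    rw [cubicForm_eq_sum_signs h, Fin.sum_univ_succ (n := 3)]
    simp only [Fin.cons_zero, Fin.cons_succ, linForm]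

/-! ### Ranks in the family -/

theorem waringRank_cubicForm_eq_four {a b c t : ℂ} (ht : t ≠ 0)
    (h : 1 + 24 * (a * b * c) * t ≠ 0) : waringRank 3 (cubicForm a b c t) = 4 := by
  refine waringRank_eq_succ three_ne_zero (cubicForm_exists_sum_four_cubes a b c ht) fun hd => ?_
  obtain ⟨p, q, r, hpqr⟩ := exists_cubicDecomposition hd
  exact h hpqr.aronhold_eq_zero

theorem waringRank_cubicForm_eq_three {a b c : ℂ} (h : a * b * c ≠ 0) :
    waringRank 3 (cubicForm a b c (-1 / (24 * (a * b * c)))) = 3 := by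
  refine waringRank_eq_succ three_ne_zero ?_ fun hd => ?_
  · refine exists_sum_cubes (isHomogeneous_X ℂ 0) (isHomogeneous_X ℂ 1) (isHomogeneous_X ℂ 2)
      (fun _ => -1 / (24 * (a * b * c))) ![-a, a, a] ![b, -b, b] ![c, c, -c] ?_
    rw [cubicForm_eq_sum_signs h, neg_div, neg_add_cancel, C_0, zero_mul, zero_add]
  · obtain ⟨p, q, r, hpqr⟩ := exists_cubicDecomposition hd
    -- At this parameter the minor condition reads `1 - 18/24 = 0`, which is absurd.
    have hm := hpqr.minor_eq_zero
    generalize a * b * c = s at h hm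
    field_simp at hm
    norm_num at hm

theorem proposition3p5 (a b c : ℂ) :
    (a * b * c ≠ 0 →
      ∃! t₀ : ℂ, t₀ ≠ 0 ∧ ∀ t : ℂ, t ≠ 0 →
        (t = t₀ → waringRank 3 (cubicForm a b c t) = 3) ∧
        (t ≠ t₀ → waringRank 3 (cubicForm a b c t) = 4)) ∧
    (a * b * c = 0 → ∀ t : ℂ, t ≠ 0 → waringRank 3 (cubicForm a b c t) = 4) := by
  refine ⟨fun h => ?_, fun h t ht => waringRank_cubicForm_eq_four ht (by simp [h])⟩
  have h0 : -1 / (24 * (a * b * c)) ≠ 0 :=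
    div_ne_zero (by norm_num) (mul_ne_zero (by norm_num) h)
  refine ⟨-1 / (24 * (a * b * c)), ⟨h0, fun t ht => ⟨?_, fun hne => ?_⟩⟩, ?_⟩
  · rintro rfl
    exact waringRank_cubicForm_eq_three h
  · refine waringRank_cubicForm_eq_four ht fun hS => hne ?_
    rw [eq_div_iff (mul_ne_zero (by norm_num) h)]
    linear_combination hS
  · rintro t₁ ⟨-, ht₁⟩
    by_contra hne
    -- A different `t₁` would assign rank 4 to the parameter already known to have rank 3.
    have h4 := (ht₁ _ h0).2 (Ne.symm hne)
    rw [waringRank_cubicForm_eq_three h] at h4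
    norm_num at h4
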